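/- Let $\mathcal Z$ be a compact metric space, $\mu$ a Borel probability measure on $\mathcal Z$ whose support is $\mathcal Z$, and $\psi_1,\dots,\psi_p$ real-valued random functions on $\mathcal Z$ (jointly measurable in the random outcome and the point of $\mathcal Z$, with respect to the $\sigma$-algebra that carries the randomness of $\boldsymbol\psi=(\psi_1,\dots,\psi_p)^\top$). Let $z_1,\dots,z_n,z_{test}$ be i.i.d. with distribution $\mu$, let $\mathbf e_1,\dots,\mathbf e_n,\mathbf e_{test}$ be i.i.d. random vectors in $\mathbb R^p$ with independent elements of mean zero and unit variance, and suppose that $\boldsymbol\psi$, the latent variables $z_1,\dots,z_n,z_{test}$ and the noise vectors $\mathbf e_1,\dots,\mathbf e_n,\mathbf e_{test}$ are three independent sources of randomness. For $\sigma_x\ge 0$ put $\mathbf x_i=\boldsymbol\psi(z_i)+\sigma_x\mathbf e_i$ and $\mathbf x_{test}=\boldsymbol\psi(z_{test})+\sigma_x\mathbf e_{test}$, and let $\mathbf X$ and $\mathbf E$ be the $n\times p$ matrices with rows $\mathbf x_i^\top$ and $\mathbf e_i^\top$ respectively. Assume that for each $j$ the random function $\psi_j$ is pointwise square integrable and mean-square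 continuous: $\mathbb E|\psi_j(z)|^2<\infty$ and $\lim_{z'\to z}\mathbb E|\psi_j(z)-\psi_j(z')|^2=0$ for all $z\in\mathcal Z$. Let $\lambda_1\ge\lambda_2\ge\dots\ge 0$ be the non-zero eigenvalues, with multiplicity and followed by zeros if there are finitely many, of the integral operator on $L_2(\mu)$ with kernel $(z,z')\mapsto p^{-1}\mathbb E\langle\boldsymbol\psi(z),\boldsymbol\psi(z')\rangle_2$, let $k_{\max}\in\{0,1,\dots\}\cup\{\infty\}$ be the number of non-zero eigenvalues, and let $u_k$, $1\le k\le k_{\max}$ ($k<\infty$), be corresponding orthonormal eigenfunctions, complete up to the null space of the operator. Put $\phi(z)=[\lambda_1^{1/2}u_1(z)\;\lambda_2^{1/2}u_2(z)\;\cdots]^\top$ (with zero entries for $k>k_{\max}$), let $\boldsymbol\Phi$ be the $n\times\infty$ matrix with rows $\phi(z_i)^\top$, and let $\mathbf W$ be the random $p\times\infty$ matrix $$\mathbf W_{jk}=(\lambda_k p)^{-1/2}\int_{\mathcal Z}\psi_j(z)u_k(z)\,\mu(\mathrm dz)\quad(k\le k_{\max}),\qquad \mathbf W_{jk}=0\quad(k>k_{\max}).$$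 If $\sum_{k\ge1}k\lambda_k<\infty$, then almost surely the integrals defining $\mathbf W$ exist, the series defining the matrix products $\boldsymbol\Phi\mathbf W^\top$ and $\mathbf W\phi(z_{test})$ converge (as limits of their partial sums over $k\le r$ as $r\to\infty$), and $$\mathbf X=p^{1/2}\boldsymbol\Phi\mathbf W^\top+\sigma_x\mathbf E,\qquad \mathbf x_{test}=p^{1/2}\mathbf W\phi(z_{test})+\sigma_x\mathbf e_{test}.$$ Moreover the entries of $\mathbf W^\top\mathbf W$ are integrable and $\mathbb E[\mathbf W^\top\mathbf W]=\mathbf I$, the identity matrix of size $k_{\max}$ (padded by zeros to an $\infty\times\infty$ matrix if $k_{\max}<\infty$). -/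

import Mathlib

open MeasureTheory ProbabilityTheory Filter Topology
open scoped Matrix

noncomputable section

namespace LatentMetricModel

/-- The family `x 1, …, x n` together with the test object, which gets the index `none`. -/
def withTest {n : ℕ} {α : Type*} (x : Fin n → α) (xtest : α) : Option (Fin n) → α
  | none => xtest
  | some i => x i

/-- The latent metric model, with test data.  The random functions are `ψ j ω z`, the latent variables
`z i ω`, `ztest ω`, and the noise vectors `e i ω`, `etest ω`. -/
structure IsLMM {Ω Z : Type*} [mΩ : MeasurableSpace Ω] [MetricSpace Z] [mZ : MeasurableSpace Z]
    {n p : ℕ} (P : Measure Ω) (μ : Measure Z) (σ : ℝ) (ψ : Fin p → Ω → Z → ℝ)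
    (z : Fin n → Ω → Z) (ztest : Ω → Z)
    (e : Fin n → Ω → Fin p → ℝ) (etest : Ω → Fin p → ℝ) : Prop where
  /-- the latent distribution is a probability measure whose support is the whole latent space -/
  isProbabilityMeasure_latent : IsProbabilityMeasure μ
  support_latent : μ.support = Set.univ
  sigma_nonneg : 0 ≤ σ
  /-- the latent variables are i.i.d. with distribution `μ` -/
  measurable_z : ∀ i, Measurable (withTest z ztest i)
  map_z : ∀ i, P.map (withTest z ztest i) = μ
  iIndepFun_z : iIndepFun (withTest z ztest) P
  /-- the noise vectors are i.i.d., with independent, centred elements of unit variance -/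
  measurable_e : ∀ i, Measurable (withTest e etest i)
  identDistrib_e : ∀ i i', IdentDistrib (withTest e etest i) (withTest e etest i') P P
  iIndepFun_e : iIndepFun (withTest e etest) P
  iIndepFun_elements : ∀ i, iIndepFun (fun (j : Fin p) ω => withTest e etest i ω j) P
  memLp_e : ∀ i j, MemLp (fun ω => withTest e etest i ω j) 2 P
  mean_e : ∀ i j, ∫ ω, withTest e etest i ω j ∂P = 0
  variance_e : ∀ i j, variance (fun ω => withTest e etest i ω j) P = 1
  /-- The random functions, the latent variables and the noise are three independent sources of
  randomness: `𝓖` is the information carried by the random functions, which are jointly measurable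
  functions of the random outcome and of the point of the latent space. -/
  independent_sources : ∃ 𝓖 : MeasurableSpace Ω, 𝓖 ≤ mΩ ∧
    (∀ j, Measurable[𝓖.prod mZ] (fun q : Ω × Z => ψ j q.1 q.2)) ∧
    iIndep ![𝓖,
      MeasurableSpace.comap (fun ω i => withTest z ztest i ω) MeasurableSpace.pi,
      MeasurableSpace.comap (fun ω i => withTest e etest i ω) MeasurableSpace.pi] P

section Objects

variable {Ω Z : Type*} [MeasurableSpace Ω] [MeasurableSpace Z] {n p : ℕ}

/-- Pointwise square integrability and mean-square continuity of a random function. -/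
def IsMeanSquareContinuous [TopologicalSpace Z] (P : Measure Ω) (f : Ω → Z → ℝ) : Prop :=
  (∀ z, MemLp (fun ω => f ω z) 2 P) ∧
    ∀ z, Tendsto (fun z' => ∫ ω, |f ω z - f ω z'| ^ 2 ∂P) (𝓝 z) (𝓝 0)

/-- The implicit kernel `(z, z') ↦ p⁻¹ E ⟨ψ(z), ψ(z')⟩`. -/
def implicitKernel (P : Measure Ω) (ψ : Fin p → Ω → Z → ℝ) (z z' : Z) : ℝ :=
  (p : ℝ)⁻¹ * ∫ ω, (∑ j, ψ j ω z * ψ j ω z') ∂P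

/-- The integral operator of a kernel. -/
def kernelOp (μ : Measure Z) (K : Z → Z → ℝ) (h : Z → ℝ) (z : Z) : ℝ :=
  ∫ z', K z z' * h z' ∂μ

/-- `(lam k, u k)`, `k = 0, 1, …`, is an eigensystem of the integral operator of `K` on `L²(μ)`: the
`lam k` are its non-zero eigenvalues in decreasing order and with multiplicity, followed by zeros if
there are only finitely many, and the `u k` with `lam k ≠ 0` are corresponding orthonormal
eigenfunctions which, up to the null space of the operator, are complete.  (A sequence cannot in
general enumerate a basis of the null space as well without breaking the order of the
eigenvalues; `u k` is irrelevant if `lam k = 0`.) -/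
structure IsEigensystem (μ : Measure Z) (K : Z → Z → ℝ) (lam : ℕ → ℝ) (u : ℕ → Z → ℝ) : Prop where
  nonneg : ∀ k, 0 ≤ lam k
  antitone : Antitone lam
  memLp : ∀ k, lam k ≠ 0 → MemLp (u k) 2 μ
  orthonormal : ∀ k l, lam k ≠ 0 → lam l ≠ 0 → ∫ z, u k z * u l z ∂μ = if k = l then 1 else 0
  eigen : ∀ k, lam k ≠ 0 → kernelOp μ K (u k) =ᵐ[μ] fun z => lam k * u k z
  complete : ∀ h : Z → ℝ, MemLp h 2 μ → (∀ k, lam k ≠ 0 → ∫ z, h z * u k z ∂μ = 0) →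
    kernelOp μ K h =ᵐ[μ] 0

/-- The number of non-zero eigenvalues, possibly `∞`. -/
def kmax (lam : ℕ → ℝ) : ℕ∞ := {k | lam k ≠ 0}.encard

/-- The feature map `φ(z) = (lam k ^ (1/2) * u k z)_k`. -/
def feature (lam : ℕ → ℝ) (u : ℕ → Z → ℝ) (z : Z) (k : ℕ) : ℝ := Real.sqrt (lam k) * u k z

/-- The `n × ∞` matrix `Φ` with rows `φ(z i)`. -/
def featureMatrix (lam : ℕ → ℝ) (u : ℕ → Z → ℝ) (z : Fin n → Ω → Z) (ω : Ω) :
    Matrix (Fin n) ℕ ℝ :=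
  Matrix.of fun i k => feature lam u (z i ω) k

open Classical in
/-- The random `p × ∞` matrix `W` of normalised Karhunen–Loève coefficients. -/
def klMatrix (μ : Measure Z) (ψ : Fin p → Ω → Z → ℝ) (lam : ℕ → ℝ) (u : ℕ → Z → ℝ) (ω : Ω) :
    Matrix (Fin p) ℕ ℝ :=
  Matrix.of fun j k =>
    if (k : ℕ∞) < kmax lam then (Real.sqrt (lam k * p))⁻¹ * ∫ z, ψ j ω z * u k z ∂μ else 0

/-- The covariate vector `ψ(z) + σ e`. -/
def covariate (ψ : Fin p → Ω → Z → ℝ) (σ : ℝ) (z : Ω → Z) (e : Ω → Fin p → ℝ) (ω : Ω) : Fin p → ℝ :=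
  fun j => ψ j ω (z ω) + σ * e ω j

/-- The `n × p` matrix `X` whose rows are the covariate vectors. -/
def covariateMatrix (ψ : Fin p → Ω → Z → ℝ) (σ : ℝ) (z : Fin n → Ω → Z) (e : Fin n → Ω → Fin p → ℝ)
    (ω : Ω) : Matrix (Fin n) (Fin p) ℝ :=
  Matrix.of fun i => covariate ψ σ (z i) (e i) ω

/-- The `n × p` matrix `E` whose rows are the noise vectors. -/
def noiseMatrix (e : Fin n → Ω → Fin p → ℝ) (ω : Ω) : Matrix (Fin n) (Fin p) ℝ :=
  Matrix.of fun i => e i ω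

end Objects

/-- The series `a 0 + a 1 + …` converges, as the limit of its partial sums, to `s`. -/
def SeriesConvergesTo (a : ℕ → ℝ) (s : ℝ) : Prop :=
  Tendsto (fun r => ∑ k ∈ Finset.range r, a k) atTop (𝓝 s)

/-- The infinite sums defining the product of an `m × ∞` and an `∞ × q` matrix converge, and the
product is `C`. -/
def IsProduct {m q : Type*} (A : Matrix m ℕ ℝ) (B : Matrix ℕ q ℝ) (C : Matrix m q ℝ) : Prop :=
  ∀ i j, SeriesConvergesTo (fun k => A i k * B k j) (C i j)

/-- The infinite sums defining the product of an `m × ∞` matrix and a vector converge, and the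
product is `w`. -/
def IsProductVec {m : Type*} (A : Matrix m ℕ ℝ) (v : ℕ → ℝ) (w : m → ℝ) : Prop :=
  ∀ i, SeriesConvergesTo (fun k => A i k * v k) (w i)

open Classical in
/-- The identity matrix of size `r ∈ {0, 1, …, ∞}`, padded by zeros to an `∞ × ∞` matrix. -/
def idMatrix (r : ℕ∞) : Matrix ℕ ℕ ℝ :=
  Matrix.of fun k l => if k = l ∧ (k : ℕ∞) < r then 1 else 0

end LatentMetricModel

end

namespace LatentMetricModel

/-! This is the Karhunen–Loève expansion of the paths of `ψ j`, evaluated at an independent random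
point. Compactness and mean-square continuity put `ψ j` in `L²(P ⊗ μ)`, and Fubini gives the key
identity (`integral_kernelOp_mul`): the quadratic form of the integral operator is `p⁻¹ ∑ j` of the
mixed moments of the path coefficients. It has two uses. For eigenfunctions it shows that
coefficients of different index are uncorrelated after summation over `j`, with total second moment
`p * lam k`; after normalisation this is `E[WᵀW] = I`. For `h` orthogonal to all eigenfunctions the
form vanishes, so almost every path is orthogonal to `h` and hence lies in the closed span of the
eigenfunctions (`ae_inner_eq_zero`).

`L²` convergence of the expansion does not suffice at a random point. The hypothesis on `lam` makes
`∑ (k + 1) c k ^ 2` finite almost surely for the coefficients `c` of a path, so the squared `L²(μ)`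
errors of the partial sums are themselves summable, and the errors tend to zero `μ`-a.e.
(`ae_tendsto_sum_of_summable`). Fubini turns this into convergence `P ⊗ μ`-a.e., and by independence
the product measure is the joint law of the random functions and a latent variable. -/

/-- If `∑ (k + 1) a k` converges, then so does the series of the tails of `∑ a k`. -/
theorem summable_tails {a : ℕ → ℝ} (ha : ∀ k, 0 ≤ a k)
    (hs : Summable fun k : ℕ => ((k : ℝ) + 1) * a k) : Summable fun r => ∑' k, a (k + r) := by
  have h : Summable fun q : ℕ × ℕ => a (q.1 + q.2) := by
    -- Sum over antidiagonals: `a n` occurs once for each of the `n + 1` pairs with sum `n`.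
    rw [← Finset.HasAntidiagonal.sigmaAntidiagonalEquivProd.summable_iff, summable_sigma_of_nonneg]
    · refine ⟨fun n => (hasSum_fintype _).summable, ?_⟩
      refine hs.congr fun n => ?_
      have : ∀ y : Finset.HasAntidiagonal.antidiagonal n, a (y.1.1 + y.1.2) = a n := by
        rintro ⟨y, hy⟩
        rw [Finset.HasAntidiagonal.mem_antidiagonal.1 hy]
      simp [tsum_fintype, Finset.HasAntidiagonal.sigmaAntidiagonalEquivProd, this]
    · exact fun _ => ha _
  refine h.prod.congr fun r => ?_
  exact tsum_congr fun k => by rw [add_comm]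

/-! ### Orthogonal expansions in a Hilbert space -/

section Hilbert

variable {E : Type*} [NormedAddCommGroup E] [InnerProductSpace ℝ E]

/-- An orthonormal family expands every vector of its closed span. -/
theorem hasSum_inner_smul_of_mem_orthogonal_orthogonal [CompleteSpace E] {ι : Type*} {v : ι → E}
    (hv : Orthonormal ℝ v) {x : E}
    (hx : ∀ y : E, (∀ i, inner ℝ (v i) y = 0) → inner ℝ y x = 0) :
    HasSum (fun i => inner ℝ (v i) x • v i) x := by
  classical
  have hsum : Summable fun i => inner ℝ (v i) x • v i := by
    have := (hv.orthogonalFamily.summable_iff_norm_sq_summable (fun i => inner ℝ (v i) x)).2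
      (hv.inner_products_summable x)
    simpa using this
  obtain ⟨y, hy⟩ := hsum
  have hvy : ∀ i, inner ℝ (v i) y = inner ℝ (v i) x := fun i => by
    have h1 := hy.mapL (innerSL ℝ (v i))
    have h2 : HasSum (fun j => innerSL ℝ (v i) (inner ℝ (v j) x • v j)) (inner ℝ (v i) x) := by
      have : ∀ j, innerSL ℝ (v i) (inner ℝ (v j) x • v j) = if j = i then inner ℝ (v i) x else 0 := by
        intro j
        rw [innerSL_apply_apply, inner_smul_right, orthonormal_iff_ite.1 hv]
        by_cases h : j = i
        · subst h; simp
        · simp [h, Ne.symm h]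
      simp only [this]
      exact hasSum_ite_eq i _
    exact h1.unique h2
  have hperp : ∀ i, inner ℝ (v i) (x - y) = 0 := fun i => by rw [inner_sub_right, hvy, sub_self]
  -- The residual is orthogonal to every `v i`, hence to `x` by hypothesis and to `y` as a limit of
  -- combinations of the `v i`; so it is orthogonal to itself.
  have h1 : inner ℝ (x - y) x = 0 := hx _ hperp
  have h2 : inner ℝ (x - y) y = 0 := by
    have h := hy.mapL (innerSL ℝ (x - y))
    have h0 : ∀ i, innerSL ℝ (x - y) (inner ℝ (v i) x • v i) = 0 := fun i => by
      rw [innerSL_apply_apply, inner_smul_right, real_inner_comm (v i), hperp, mul_zero]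
    simp only [h0] at h
    exact h.unique hasSum_zero
  have h3 : x - y = 0 := by
    rw [← inner_self_eq_zero (𝕜 := ℝ), inner_sub_right, h1, h2, sub_zero]
  rwa [← sub_eq_zero.1 h3] at hy

/-- The squared error of the partial sums of an orthogonal expansion is the tail of the series of
squared coefficients. -/
theorem norm_sub_sum_sq_eq_tsum [CompleteSpace E] {v : ℕ → E} {S : Set ℕ}
    (hv : ∀ k l, inner ℝ (v k) (v l) = S.indicator (fun k => if k = l then (1 : ℝ) else 0) k) {x : E}
    (hx : ∀ y : E, (∀ i, inner ℝ (v i) y = 0) → inner ℝ y x = 0) (r : ℕ) :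
    ‖x - ∑ k ∈ Finset.range r, inner ℝ (v k) x • v k‖ ^ 2 = ∑' k, inner ℝ (v (k + r)) x ^ 2 := by
  classical
  -- The family is orthonormal on `S` and zero elsewhere, which allows finitely many eigenfunctions
  -- to be padded to a sequence.
  have hv0 : ∀ k, k ∉ S → v k = 0 := fun k hk => by
    rw [← inner_self_eq_zero (𝕜 := ℝ), hv, Set.indicator_of_notMem hk]
  have hon : Orthonormal ℝ fun i : S => v i := by
    rw [orthonormal_iff_ite]
    intro i j
    rw [hv, Set.indicator_of_mem i.2]
    simp [Subtype.ext_iff]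
  have hexp : HasSum (fun k => inner ℝ (v k) x • v k) x := by
    have h := hasSum_inner_smul_of_mem_orthogonal_orthogonal hon (x := x) fun y hy => hx y fun i => by
      by_cases hi : i ∈ S
      · exact hy ⟨i, hi⟩
      · rw [hv0 i hi, inner_zero_left]
    refine (hasSum_subtype_iff_of_support_subset (s := S) ?_).1 h
    intro k hk
    by_contra hkS
    exact hk (by simp [hv0 k hkS])
  have hgg : ∀ k, inner ℝ (v k) x * (inner ℝ (v k) x * inner ℝ (v k) (v k)) = inner ℝ (v k) x ^ 2 := by
    intro k
    by_cases hk : k ∈ S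
    · rw [hv, Set.indicator_of_mem hk]; simp [sq]
    · simp [hv0 k hk]
  have hpart : ∀ r, ‖x - ∑ k ∈ Finset.range r, inner ℝ (v k) x • v k‖ ^ 2
      = ‖x‖ ^ 2 - ∑ k ∈ Finset.range r, inner ℝ (v k) x ^ 2 := by
    intro r
    have h1 : inner ℝ x (∑ k ∈ Finset.range r, inner ℝ (v k) x • v k)
        = ∑ k ∈ Finset.range r, inner ℝ (v k) x ^ 2 := by
      rw [inner_sum]
      refine Finset.sum_congr rfl fun k _ => ?_
      rw [inner_smul_right, real_inner_comm, sq]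
    have h2 : ‖∑ k ∈ Finset.range r, inner ℝ (v k) x • v k‖ ^ 2
        = ∑ k ∈ Finset.range r, inner ℝ (v k) x ^ 2 := by
      rw [← real_inner_self_eq_norm_sq, sum_inner]
      refine Finset.sum_congr rfl fun k hk => ?_
      rw [inner_sum, Finset.sum_eq_single_of_mem k hk]
      · rw [inner_smul_left, inner_smul_right, ← hgg]; simp
      · intro l _ hl
        rw [inner_smul_left, inner_smul_right, hv]
        simp [Set.indicator, Ne.symm hl]
    rw [norm_sub_sq_real, h1, h2]
    ring
  have htend : Tendsto (fun r => ∑ k ∈ Finset.range r, inner ℝ (v k) x ^ 2) atTop (𝓝 (‖x‖ ^ 2)) := by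
    have h0 : Tendsto (fun r => ‖x - ∑ k ∈ Finset.range r, inner ℝ (v k) x • v k‖ ^ 2) atTop (𝓝 0) := by
      have := ((tendsto_const_nhds (x := x)).sub hexp.tendsto_sum_nat).norm.pow 2
      simpa using this
    have := (tendsto_const_nhds (x := ‖x‖ ^ 2)).sub h0
    simpa [hpart] using this
  have hsum : HasSum (fun k => inner ℝ (v k) x ^ 2) (‖x‖ ^ 2) :=
    (hasSum_iff_tendsto_nat_of_nonneg (fun _ => sq_nonneg _) _).2 htend
  rw [hpart, ← hsum.tsum_eq, ← hsum.summable.sum_add_tsum_nat_add r, add_sub_cancel_left]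

end Hilbert

/-! ### Almost everywhere convergence of orthogonal expansions -/

section Measure

variable {X : Type*} [MeasurableSpace X] {μ : Measure X}

/-- By Tonelli the sum has finite integral, so it is finite almost everywhere. -/
theorem ae_summable_of_summable_integral {F : ℕ → X → ℝ} (hF : ∀ k, Integrable (F k) μ)
    (h0 : ∀ k x, 0 ≤ F k x) (hs : Summable fun k => ∫ x, F k x ∂μ) :
    ∀ᵐ x ∂μ, Summable fun k => F k x := by
  have hm : ∀ k, AEMeasurable (fun x => ENNReal.ofReal (F k x)) μ := fun k =>
    (hF k).aestronglyMeasurable.aemeasurable.ennreal_ofReal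
  have hfin : ∫⁻ x, ∑' k, ENNReal.ofReal (F k x) ∂μ ≠ ⊤ := by
    rw [lintegral_tsum hm]
    simp_rw [← fun k => ofReal_integral_eq_lintegral_ofReal (hF k) (ae_of_all _ (h0 k))]
    exact hs.tsum_ofReal_ne_top
  filter_upwards [ae_lt_top' (AEMeasurable.tsum hm) hfin] with x hx
  refine (ENNReal.summable_toReal hx.ne).congr fun k => ?_
  exact ENNReal.toReal_ofReal (h0 k x)

theorem inner_toLp_eq_integral {f g : X → ℝ} (hf : MemLp f 2 μ) (hg : MemLp g 2 μ) :
    inner ℝ (hf.toLp f) (hg.toLp g) = ∫ x, f x * g x ∂μ := by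
  rw [L2.inner_def]
  refine integral_congr_ae ?_
  filter_upwards [hf.coeFn_toLp, hg.coeFn_toLp] with x h1 h2
  rw [h1, h2, real_inner_eq_re_inner, RCLike.inner_apply]
  simp [mul_comm]

theorem sq_integral_mul_le {f g : X → ℝ} (hf : MemLp f 2 μ) (hg : MemLp g 2 μ) :
    (∫ x, f x * g x ∂μ) ^ 2 ≤ (∫ x, f x ^ 2 ∂μ) * ∫ x, g x ^ 2 ∂μ := by
  have h := real_inner_mul_inner_self_le (hf.toLp f) (hg.toLp g)
  simpa only [inner_toLp_eq_integral, ← sq] using h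

theorem integrable_mul_of_memLp_two {f g : X → ℝ} (hf : MemLp f 2 μ) (hg : MemLp g 2 μ) :
    Integrable (fun x => f x * g x) μ := hf.integrable_mul hg

/-- Orthogonal expansions with sufficiently small coefficients converge almost everywhere. -/
theorem ae_tendsto_sum_of_summable {v : ℕ → X → ℝ} {S : Set ℕ} (hv : ∀ k, MemLp (v k) 2 μ)
    (hon : ∀ k l, ∫ x, v k x * v l x ∂μ = S.indicator (fun k => if k = l then (1 : ℝ) else 0) k)
    {f : X → ℝ} (hf : MemLp f 2 μ)
    (hspan : ∀ y : Lp ℝ 2 μ, (∀ k, inner ℝ ((hv k).toLp (v k)) y = 0) → inner ℝ y (hf.toLp f) = 0)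
    (hs : Summable fun k : ℕ => ((k : ℝ) + 1) * (∫ x, f x * v k x ∂μ) ^ 2) :
    ∀ᵐ x ∂μ, Tendsto (fun r => ∑ k ∈ Finset.range r, (∫ y, f y * v k y ∂μ) * v k x) atTop
      (𝓝 (f x)) := by
  set c : ℕ → ℝ := fun k => ∫ x, f x * v k x ∂μ with hc
  have hcin : ∀ k, inner ℝ ((hv k).toLp (v k)) (hf.toLp f) = c k := fun k => by
    rw [inner_toLp_eq_integral, hc]
    simp only [mul_comm]
  have hR : ∀ r, MemLp (fun x => f x - ∑ k ∈ Finset.range r, c k * v k x) 2 μ := fun r =>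
    hf.sub (memLp_finsetSum _ fun k _ => (hv k).const_mul (c k))
  have hRr : ∀ r, (hR r).toLp _ = hf.toLp f - ∑ k ∈ Finset.range r, c k • (hv k).toLp (v k) := by
    intro r
    induction r with
    | zero => simp
    | succ r ih =>
      rw [Finset.sum_range_succ, ← sub_sub, ← ih, ← MemLp.toLp_const_smul, ← MemLp.toLp_sub]
      refine MemLp.toLp_congr _ _ (ae_of_all _ fun x => ?_)
      simp [Finset.sum_range_succ, sub_sub]
  have hnorm : ∀ r, ∫ x, (f x - ∑ k ∈ Finset.range r, c k * v k x) ^ 2 ∂μ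
      = ∑' k, c (k + r) ^ 2 := by
    intro r
    have h := norm_sub_sum_sq_eq_tsum (v := fun k => (hv k).toLp (v k)) (S := S)
      (fun k l => by rw [inner_toLp_eq_integral, hon]) hspan r
    simp only [hcin] at h
    rw [← h, ← hRr, ← real_inner_self_eq_norm_sq, inner_toLp_eq_integral]
    simp only [sq]
  -- The squared errors of all partial sums are added up: their integrals are the tails of `∑ c k ^
  -- 2`, which form a summable sequence. The terms of an a.e. convergent series tend to zero, so no
  -- subsequence is needed.
  have hae := ae_summable_of_summable_integral (μ := μ)
    (F := fun r x => (f x - ∑ k ∈ Finset.range r, c k * v k x) ^ 2)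
    (fun r => (hR r).integrable_sq) (fun _ _ => sq_nonneg _)
    (by simpa only [hnorm] using summable_tails (fun k => sq_nonneg (c k)) hs)
  filter_upwards [hae] with x hx
  have h0 := hx.tendsto_atTop_zero
  have h1 : Tendsto (fun r => f x - ∑ k ∈ Finset.range r, c k * v k x) atTop (𝓝 0) := by
    rw [tendsto_zero_iff_abs_tendsto_zero]
    have := (Real.continuous_sqrt.tendsto 0).comp h0
    simpa [Function.comp_def, Real.sqrt_sq_eq_abs] using this
  simpa using (tendsto_const_nhds (x := f x)).sub h1

end Measure

/-! ### Square integrable random functions and Fubini -/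

section RandomFunctions

theorem integrable_prod_mul_mul {Ω Z : Type*} [MeasurableSpace Ω] [MeasurableSpace Z]
    {P : Measure Ω} [SFinite P] {μ : Measure Z} [SFinite μ] {f : Ω → Z → ℝ}
    (hf : MemLp (fun q : Ω × Z => f q.1 q.2) 2 (P.prod μ))
    {a : Ω → ℝ} (ha : MemLp a 2 P) {h : Z → ℝ} (hh : MemLp h 2 μ) :
    Integrable (fun q : Ω × Z => a q.1 * f q.1 q.2 * h q.2) (P.prod μ) := by
  have h1 : MemLp (fun q : Ω × Z => a q.1 * h q.2) 2 (P.prod μ) := by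
    refine (memLp_two_iff_integrable_sq
      (ha.aestronglyMeasurable.comp_fst.mul hh.aestronglyMeasurable.comp_snd)).2 ?_
    refine (ha.integrable_sq.mul_prod hh.integrable_sq).congr (ae_of_all _ fun q => ?_)
    exact (mul_pow _ _ 2).symm
  refine (integrable_mul_of_memLp_two h1 hf).congr (ae_of_all _ fun q => ?_)
  ring

/-- Second moments are locally bounded by mean-square continuity; compactness makes the bound
uniform. -/
theorem IsMeanSquareContinuous.exists_integral_sq_le {Ω Z : Type*} [MeasurableSpace Ω]
    {P : Measure Ω} [TopologicalSpace Z] [CompactSpace Z] {f : Ω → Z → ℝ} (hf : IsMeanSquareContinuous P f) : ∃ C, ∀ x, ∫ ω, f ω x ^ 2 ∂P ≤ C := by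
  have h : ∃ C, ∀ x ∈ (Set.univ : Set Z), ∫ ω, f ω x ^ 2 ∂P ≤ C := by
    refine isCompact_univ.induction_on (p := fun s => ∃ C, ∀ x ∈ s, ∫ ω, f ω x ^ 2 ∂P ≤ C)
      ⟨0, by simp⟩ ?_ ?_ ?_
    · rintro s t hst ⟨C, hC⟩
      exact ⟨C, fun x hx => hC x (hst hx)⟩
    · rintro s t ⟨C, hC⟩ ⟨D, hD⟩
      refine ⟨max C D, ?_⟩
      rintro x (hx | hx)
      · exact (hC x hx).trans (le_max_left _ _)
      · exact (hD x hx).trans (le_max_right _ _)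
    · intro x _
      refine ⟨{y | ∫ ω, |f ω x - f ω y| ^ 2 ∂P < 1},
        mem_nhdsWithin_of_mem_nhds ((hf.2 x).eventually_lt_const one_pos),
        2 * ∫ ω, f ω x ^ 2 ∂P + 2, fun y hy => ?_⟩
      have hd : Integrable (fun ω => |f ω x - f ω y| ^ 2) P := by
        simp only [sq_abs]
        exact ((hf.1 x).sub (hf.1 y)).integrable_sq
      calc ∫ ω, f ω y ^ 2 ∂P
          ≤ ∫ ω, (2 * f ω x ^ 2 + 2 * |f ω x - f ω y| ^ 2) ∂P := by
            refine integral_mono (hf.1 y).integrable_sq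
              (((hf.1 x).integrable_sq.const_mul 2).add (hd.const_mul 2)) fun ω => ?_
            simp only [sq_abs]
            -- With `a = f ω x`, `b = f ω y`: `2a² + 2(a - b)² - b² = (2a - b)²`.
            nlinarith [sq_nonneg (2 * f ω x - f ω y)]
        _ = 2 * ∫ ω, f ω x ^ 2 ∂P + 2 * ∫ ω, |f ω x - f ω y| ^ 2 ∂P := by
            rw [integral_add ((hf.1 x).integrable_sq.const_mul 2) (hd.const_mul 2),
              integral_const_mul, integral_const_mul]
        _ ≤ _ := by
            have : ∫ ω, |f ω x - f ω y| ^ 2 ∂P < 1 := hy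
            linarith
  obtain ⟨C, hC⟩ := h
  exact ⟨C, fun x => hC x trivial⟩

variable {Ω Z : Type*} [MeasurableSpace Ω] [MeasurableSpace Z]
  {P : Measure Ω} [IsProbabilityMeasure P] {μ : Measure Z} [IsProbabilityMeasure μ]

theorem IsMeanSquareContinuous.memLp_prod [TopologicalSpace Z] [CompactSpace Z]
    {f : Ω → Z → ℝ} (hf : IsMeanSquareContinuous P f)
    (hm : Measurable fun q : Ω × Z => f q.1 q.2) :
    MemLp (fun q : Ω × Z => f q.1 q.2) 2 (P.prod μ) := by
  obtain ⟨C, hC⟩ := hf.exists_integral_sq_le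
  have hm2 : AEStronglyMeasurable (fun q : Ω × Z => f q.1 q.2 ^ 2) (P.prod μ) :=
    (hm.pow_const 2).aestronglyMeasurable
  rw [memLp_two_iff_integrable_sq hm.aestronglyMeasurable, integrable_prod_iff' hm2]
  refine ⟨ae_of_all _ fun x => (hf.1 x).integrable_sq, ?_⟩
  refine Integrable.of_bound (C := C) ?_ (ae_of_all _ fun x => ?_)
  · exact hm2.norm.prod_swap.integral_prod_right'
  · have h0 : ∀ ω, ‖f ω x ^ 2‖ = f ω x ^ 2 := fun ω => by simp
    simp only [h0]
    rw [Real.norm_of_nonneg (integral_nonneg fun _ => sq_nonneg _)]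
    exact hC x

theorem ae_memLp_section {f : Ω → Z → ℝ}
    (hf : MemLp (fun q : Ω × Z => f q.1 q.2) 2 (P.prod μ))
    (hm : Measurable fun q : Ω × Z => f q.1 q.2) :
    ∀ᵐ ω ∂P, MemLp (f ω) 2 μ := by
  filter_upwards [hf.integrable_sq.prod_right_ae] with ω hω
  exact (memLp_two_iff_integrable_sq (hm.comp measurable_prodMk_left).aestronglyMeasurable).2 hω

/-- Cauchy–Schwarz on each path bounds the square by `∫ f² * ∫ h²`, which is integrable in `ω`. -/
theorem memLp_integral_mul {f : Ω → Z → ℝ}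
    (hf : MemLp (fun q : Ω × Z => f q.1 q.2) 2 (P.prod μ))
    (hm : Measurable fun q : Ω × Z => f q.1 q.2)
    {h : Z → ℝ} (hh : MemLp h 2 μ) : MemLp (fun ω => ∫ x, f ω x * h x ∂μ) 2 P := by
  have hmeas : AEStronglyMeasurable (fun ω => ∫ x, f ω x * h x ∂μ) P :=
    (hf.aestronglyMeasurable.mul hh.aestronglyMeasurable.comp_snd).integral_prod_right'
  rw [memLp_two_iff_integrable_sq hmeas]
  refine (hf.integrable_sq.integral_prod_left.mul_const (∫ x, h x ^ 2 ∂μ)).mono' (hmeas.pow 2) ?_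
  filter_upwards [ae_memLp_section hf hm] with ω hω
  rw [Real.norm_of_nonneg (sq_nonneg _)]
  exact sq_integral_mul_le hω hh

theorem integrable_integral_mul {f : Ω → Z → ℝ}
    (hf : MemLp (fun q : Ω × Z => f q.1 q.2) 2 (P.prod μ))
    {a : Ω → ℝ} (ha : MemLp a 2 P) {h : Z → ℝ} (hh : MemLp h 2 μ) :
    Integrable (fun x => (∫ ω, a ω * f ω x ∂P) * h x) μ := by
  simpa only [integral_mul_const] using (integrable_prod_mul_mul hf ha hh).integral_prod_right

theorem integral_integral_mul_eq {f : Ω → Z → ℝ}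
    (hf : MemLp (fun q : Ω × Z => f q.1 q.2) 2 (P.prod μ))
    {a : Ω → ℝ} (ha : MemLp a 2 P) {h : Z → ℝ} (hh : MemLp h 2 μ) :
    ∫ x, (∫ ω, a ω * f ω x ∂P) * h x ∂μ = ∫ ω, a ω * ∫ x, f ω x * h x ∂μ ∂P := by
  have := integral_integral_swap (f := fun ω x => a ω * f ω x * h x)
    (integrable_prod_mul_mul hf ha hh)
  simp only [integral_mul_const] at this
  rw [← this]
  simp only [mul_assoc, integral_const_mul]

end RandomFunctions

/-! ### The integral operator and the paths -/

section Kernel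

variable {Ω Z : Type*} [MeasurableSpace Ω] [MeasurableSpace Z]
  {P : Measure Ω} [IsProbabilityMeasure P] {μ : Measure Z} [IsProbabilityMeasure μ]
  {p : ℕ} {ψ : Fin p → Ω → Z → ℝ}

theorem kernelOp_implicitKernel (hf : ∀ j, MemLp (fun q : Ω × Z => ψ j q.1 q.2) 2 (P.prod μ))
    (hpt : ∀ j x, MemLp (fun ω => ψ j ω x) 2 P) {h : Z → ℝ} (hh : MemLp h 2 μ) (x : Z) :
    kernelOp μ (implicitKernel P ψ) h x
      = (p : ℝ)⁻¹ * ∑ j, ∫ ω, ψ j ω x * ∫ y, ψ j ω y * h y ∂μ ∂P := by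
  have h1 : ∀ y, implicitKernel P ψ x y * h y
      = (p : ℝ)⁻¹ * ∑ j, (∫ ω, ψ j ω x * ψ j ω y ∂P) * h y := fun y => by
    rw [implicitKernel, integral_finsetSum _ fun j _ =>
      integrable_mul_of_memLp_two (hpt j x) (hpt j y), mul_assoc, Finset.sum_mul]
  simp only [kernelOp, h1]
  rw [integral_const_mul, integral_finsetSum _ fun j _ => integrable_integral_mul (hf j) (hpt j x) hh]
  simp only [fun j => integral_integral_mul_eq (hf j) (hpt j x) hh]

/-- The quadratic form of the integral operator of the implicit kernel. -/
theorem integral_kernelOp_mul (hm : ∀ j, Measurable fun q : Ω × Z => ψ j q.1 q.2)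
    (hf : ∀ j, MemLp (fun q : Ω × Z => ψ j q.1 q.2) 2 (P.prod μ))
    (hpt : ∀ j x, MemLp (fun ω => ψ j ω x) 2 P) {g h : Z → ℝ} (hg : MemLp g 2 μ)
    (hh : MemLp h 2 μ) :
    ∫ x, kernelOp μ (implicitKernel P ψ) h x * g x ∂μ
      = (p : ℝ)⁻¹ * ∑ j, ∫ ω, (∫ x, ψ j ω x * h x ∂μ) * ∫ x, ψ j ω x * g x ∂μ ∂P := by
  simp only [kernelOp_implicitKernel hf hpt hh, mul_assoc, Finset.sum_mul]
  -- The coefficient of `h` now plays the role of the random factor `a` in a second use of Fubini.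
  simp only [mul_comm (ψ _ _ _) (∫ y, _ ∂μ)]
  rw [integral_const_mul, integral_finsetSum _ fun j _ =>
    integrable_integral_mul (hf j) (memLp_integral_mul (hf j) (hm j) hh) hg]
  simp only [fun j => integral_integral_mul_eq (hf j) (memLp_integral_mul (hf j) (hm j) hh) hg]

/-- Almost every path lies in the closed span of functions whose orthogonal complement is
annihilated by the integral operator. -/
theorem ae_inner_eq_zero [TopologicalSpace.SeparableSpace (Lp ℝ 2 μ)]
    (hm : ∀ j, Measurable fun q : Ω × Z => ψ j q.1 q.2)
    (hf : ∀ j, MemLp (fun q : Ω × Z => ψ j q.1 q.2) 2 (P.prod μ))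
    (hpt : ∀ j x, MemLp (fun ω => ψ j ω x) 2 P)
    {v : ℕ → Z → ℝ} (hv : ∀ k, MemLp (v k) 2 μ)
    (hcomplete : ∀ h : Z → ℝ, MemLp h 2 μ → (∀ k, ∫ x, h x * v k x ∂μ = 0) →
      kernelOp μ (implicitKernel P ψ) h =ᵐ[μ] 0) (j : Fin p) :
    ∀ᵐ ω ∂P, ∀ (hω : MemLp (ψ j ω) 2 μ) (y : Lp ℝ 2 μ),
      (∀ k, inner ℝ ((hv k).toLp (v k)) y = 0) → inner ℝ y (hω.toLp (ψ j ω)) = 0 := by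
  set T : Set (Lp ℝ 2 μ) := {y | ∀ k, inner ℝ ((hv k).toLp (v k)) y = 0} with hT
  have hinner : ∀ {g : Z → ℝ} (hg : MemLp g 2 μ) (y : Lp ℝ 2 μ),
      inner ℝ (hg.toLp g) y = ∫ x, g x * y x ∂μ := fun {g} hg y => by
    conv_lhs => rw [← Lp.toLp_coeFn y (Lp.memLp y)]
    exact inner_toLp_eq_integral hg (Lp.memLp y)
  have hzero : ∀ y ∈ T, ∀ᵐ ω ∂P, ∫ x, ψ j ω x * y x ∂μ = 0 := by
    intro y hy
    have hy2 : MemLp y 2 μ := Lp.memLp y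
    have hK := hcomplete y hy2 fun k => by
      rw [← hy k, hinner]
      simp only [mul_comm]
    have hform := integral_kernelOp_mul hm hf hpt hy2 hy2
    have hl : ∫ x, kernelOp μ (implicitKernel P ψ) y x * y x ∂μ = 0 := by
      rw [← integral_zero Z ℝ (μ := μ)]
      refine integral_congr_ae ?_
      filter_upwards [hK] with x hx
      rw [hx]; simp
    rw [hl] at hform
    have hp : (p : ℝ)⁻¹ ≠ 0 := by
      have := j.pos
      positivity
    have hsum := (mul_eq_zero.1 hform.symm).resolve_left hp
    simp only [← sq] at hsum
    have hj := (Finset.sum_eq_zero_iff_of_nonneg fun i _ =>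
      integral_nonneg fun ω => sq_nonneg _).1 hsum j (Finset.mem_univ j)
    rw [integral_eq_zero_iff_of_nonneg (fun ω => sq_nonneg _)
      (memLp_integral_mul (hf j) (hm j) hy2).integrable_sq] at hj
    filter_upwards [hj] with ω hω
    exact pow_eq_zero_iff two_ne_zero |>.1 hω
  -- The null set so far depends on `y`. A countable dense subset of `T` and continuity of the inner
  -- product give a single null set for all `y`.
  have : Nonempty T := ⟨⟨0, fun k => inner_zero_right _⟩⟩
  have hall : ∀ᵐ ω ∂P, ∀ n, ∫ x, ψ j ω x * (TopologicalSpace.denseSeq T n : Lp ℝ 2 μ) x ∂μ = 0 :=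
    ae_all_iff.2 fun n => hzero _ (TopologicalSpace.denseSeq T n).2
  filter_upwards [hall] with ω hn hω y hy
  refine isClosed_property (TopologicalSpace.denseRange_denseSeq T)
    (p := fun y : T => inner ℝ (y : Lp ℝ 2 μ) (hω.toLp (ψ j ω)) = 0) ?_ ?_ ⟨y, hy⟩
  · exact isClosed_eq (continuous_subtype_val.inner continuous_const) continuous_const
  · intro n
    rw [real_inner_comm, hinner, hn]

/-- The Karhunen–Loève expansion converges almost everywhere if the eigenvalues decay. -/
theorem ae_ae_tendsto_sum [TopologicalSpace.SeparableSpace (Lp ℝ 2 μ)]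
    (hm : ∀ j, Measurable fun q : Ω × Z => ψ j q.1 q.2)
    (hf : ∀ j, MemLp (fun q : Ω × Z => ψ j q.1 q.2) 2 (P.prod μ))
    (hpt : ∀ j x, MemLp (fun ω => ψ j ω x) 2 P)
    {v : ℕ → Z → ℝ} {S : Set ℕ} (hv : ∀ k, MemLp (v k) 2 μ)
    (hon : ∀ k l, ∫ x, v k x * v l x ∂μ = S.indicator (fun k => if k = l then (1 : ℝ) else 0) k)
    (hcomplete : ∀ h : Z → ℝ, MemLp h 2 μ → (∀ k, ∫ x, h x * v k x ∂μ = 0) →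
      kernelOp μ (implicitKernel P ψ) h =ᵐ[μ] 0)
    {lam : ℕ → ℝ}
    (hcoef : ∀ k, ∑ j, ∫ ω, (∫ x, ψ j ω x * v k x ∂μ) ^ 2 ∂P ≤ p * lam k)
    (hlam : Summable fun k : ℕ => ((k : ℝ) + 1) * lam k) (j : Fin p) :
    ∀ᵐ ω ∂P, ∀ᵐ x ∂μ, Tendsto (fun r => ∑ k ∈ Finset.range r,
      (∫ y, ψ j ω y * v k y ∂μ) * v k x) atTop (𝓝 (ψ j ω x)) := by
  have hs : ∀ᵐ ω ∂P, Summable fun k : ℕ => ((k : ℝ) + 1) * (∫ x, ψ j ω x * v k x ∂μ) ^ 2 := by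
    refine ae_summable_of_summable_integral
      (fun k => (memLp_integral_mul (hf j) (hm j) (hv k)).integrable_sq.const_mul _)
      (fun k ω => by positivity) ?_
    simp only [integral_const_mul]
    refine Summable.of_nonneg_of_le (fun k => ?_) (fun k => ?_) (hlam.mul_left (p : ℝ))
    · exact mul_nonneg (by positivity) (integral_nonneg fun _ => sq_nonneg _)
    · have h1 : ∫ ω, (∫ x, ψ j ω x * v k x ∂μ) ^ 2 ∂P ≤ p * lam k :=
        (Finset.single_le_sum (f := fun j => ∫ ω, (∫ x, ψ j ω x * v k x ∂μ) ^ 2 ∂P)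
          (fun i _ => integral_nonneg fun _ => sq_nonneg _) (Finset.mem_univ j)).trans (hcoef k)
      calc ((k : ℝ) + 1) * ∫ ω, (∫ x, ψ j ω x * v k x ∂μ) ^ 2 ∂P
          ≤ ((k : ℝ) + 1) * (p * lam k) := by gcongr
        _ = _ := by ring
  filter_upwards [hs, ae_memLp_section (hf j) (hm j), ae_inner_eq_zero hm hf hpt hv hcomplete j]
    with ω hsω hω hspan
  exact ae_tendsto_sum_of_summable hv hon hω (hspan hω) hsω

end Kernel

/-- The sequence is decreasing and nonnegative, so its non-zero indices form an initial segment of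
`ℕ`. -/
theorem lt_kmax_iff {lam : ℕ → ℝ} (h0 : ∀ k, 0 ≤ lam k) (hanti : Antitone lam) (k : ℕ) :
    (k : ℕ∞) < kmax lam ↔ lam k ≠ 0 := by
  constructor
  · intro hk h
    have hsub : {i | lam i ≠ 0} ⊆ ((Finset.range k : Finset ℕ) : Set ℕ) := by
      intro i hi
      rw [Finset.coe_range, Set.mem_Iio]
      by_contra! hki
      exact hi (le_antisymm ((hanti hki).trans h.le) (h0 i))
    have := Set.encard_le_encard hsub
    rw [Set.encard_coe_eq_coe_finsetCard, Finset.card_range] at this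
    exact absurd hk (not_lt.2 this)
  · intro hk
    have hsub : ((Finset.range (k + 1) : Finset ℕ) : Set ℕ) ⊆ {i | lam i ≠ 0} := by
      intro i hi
      rw [Finset.coe_range, Set.mem_Iio, Nat.lt_succ_iff] at hi
      exact ((lt_of_le_of_ne (h0 k) (Ne.symm hk)).trans_le (hanti hi)).ne'
    have := Set.encard_le_encard hsub
    rw [Set.encard_coe_eq_coe_finsetCard, Finset.card_range] at this
    exact lt_of_lt_of_le (by exact_mod_cast Nat.lt_succ_self k) this

/-! ### Normalising the eigenfunctions -/

section Eigensystem

variable {Z : Type*} [MeasurableSpace Z] {μ : Measure Z} {K : Z → Z → ℝ}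
  {lam : ℕ → ℝ} {u : ℕ → Z → ℝ}

theorem kernelOp_congr_ae {g h : Z → ℝ} (hgh : g =ᵐ[μ] h) : kernelOp μ K g = kernelOp μ K h := by
  funext x
  refine integral_congr_ae ?_
  filter_upwards [hgh] with y hy
  rw [hy]

/-- The eigenfunctions of an eigensystem may be taken measurable, and zero where they are
irrelevant. -/
theorem IsEigensystem.exists_measurable (heig : IsEigensystem μ K lam u) :
    ∃ v : ℕ → Z → ℝ, (∀ k, Measurable (v k)) ∧ (∀ k, MemLp (v k) 2 μ) ∧
      (∀ k l, ∫ x, v k x * v l x ∂μ =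
        {k | lam k ≠ 0}.indicator (fun k => if k = l then (1 : ℝ) else 0) k) ∧
      (∀ k, kernelOp μ K (v k) =ᵐ[μ] fun x => lam k * v k x) ∧
      (∀ h : Z → ℝ, MemLp h 2 μ → (∀ k, ∫ x, h x * v k x ∂μ = 0) → kernelOp μ K h =ᵐ[μ] 0) ∧
      ∀ k, lam k ≠ 0 → v k =ᵐ[μ] u k := by
  classical
  let v : ℕ → Z → ℝ := fun k => if h : lam k ≠ 0 then (heig.memLp k h).1.mk (u k) else 0
  have hv0 : ∀ k, lam k = 0 → v k = 0 := fun k h => dif_neg (not_not.2 h)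
  have hv1 : ∀ k (h : lam k ≠ 0), v k = (heig.memLp k h).1.mk (u k) := fun k h => dif_pos h
  have hvu : ∀ k, lam k ≠ 0 → v k =ᵐ[μ] u k := fun k h => by
    rw [hv1 k h]
    exact (heig.memLp k h).1.ae_eq_mk.symm
  refine ⟨v, fun k => ?_, fun k => ?_, fun k l => ?_, fun k => ?_, fun h hh hk => ?_, hvu⟩
  · by_cases h : lam k = 0
    · rw [hv0 k h]
      exact measurable_const
    · rw [hv1 k h]
      exact (heig.memLp k h).1.stronglyMeasurable_mk.measurable
  · by_cases h : lam k = 0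
    · rw [hv0 k h]
      exact MemLp.zero
    · exact (memLp_congr_ae (hvu k h)).2 (heig.memLp k h)
  · by_cases hk : lam k = 0
    · rw [hv0 k hk, Set.indicator_of_notMem (by simpa using hk)]
      simp
    · rw [Set.indicator_of_mem (by simpa using hk)]
      by_cases hl : lam l = 0
      · have : k ≠ l := by
          rintro rfl
          exact hk hl
        rw [hv0 l hl, if_neg this]
        simp
      · rw [← heig.orthonormal k l hk hl]
        refine integral_congr_ae ?_
        filter_upwards [hvu k hk, hvu l hl] with x h1 h2
        rw [h1, h2]
  · by_cases h : lam k = 0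
    · rw [hv0 k h]
      exact ae_of_all _ fun x => by simp [kernelOp]
    · rw [kernelOp_congr_ae (hvu k h)]
      filter_upwards [heig.eigen k h, hvu k h] with x h1 h2
      rw [h1, h2]
  · refine heig.complete h hh fun k hlk => ?_
    rw [← hk k]
    refine integral_congr_ae ?_
    filter_upwards [hvu k hlk] with x hx
    rw [hx]

theorem klMatrix_apply_eq {Ω : Type*} [MeasurableSpace Ω] {p : ℕ} {ψ : Fin p → Ω → Z → ℝ}
    (h0 : ∀ k, 0 ≤ lam k) (hanti : Antitone lam) {v : ℕ → Z → ℝ}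
    (hvu : ∀ k, lam k ≠ 0 → v k =ᵐ[μ] u k) (ω : Ω) (j : Fin p) (k : ℕ) :
    klMatrix μ ψ lam u ω j k = (Real.sqrt (lam k * p))⁻¹ * ∫ x, ψ j ω x * v k x ∂μ := by
  simp only [klMatrix, Matrix.of_apply, lt_kmax_iff h0 hanti]
  split_ifs with h
  · congr 1
    refine integral_congr_ae ?_
    filter_upwards [hvu k h] with x hx
    rw [hx]
  · rw [not_not] at h
    simp [h]

end Eigensystem

/-! ### The Karhunen–Loève expansion on the product space -/

section KarhunenLoeve

variable {Ω Z : Type*} [MeasurableSpace Ω] [MetricSpace Z] [CompactSpace Z] [MeasurableSpace Z]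
  {P : Measure Ω} [IsProbabilityMeasure P] {μ : Measure Z} [IsProbabilityMeasure μ]
  {p : ℕ} {ψ : Fin p → Ω → Z → ℝ} {lam : ℕ → ℝ} {u : ℕ → Z → ℝ}

/-- The second moments of the Karhunen–Loève coefficients. -/
theorem sum_integral_coefficient_mul (hm : ∀ j, Measurable fun q : Ω × Z => ψ j q.1 q.2)
    (hψ : ∀ j, IsMeanSquareContinuous P (ψ j)) {v : ℕ → Z → ℝ} {S : Set ℕ}
    (hv : ∀ k, MemLp (v k) 2 μ)
    (hon : ∀ k l, ∫ x, v k x * v l x ∂μ = S.indicator (fun k => if k = l then (1 : ℝ) else 0) k)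
    (heigen : ∀ k, kernelOp μ (implicitKernel P ψ) (v k) =ᵐ[μ] fun x => lam k * v k x) (k l : ℕ) :
    ∑ j, ∫ ω, (∫ x, ψ j ω x * v k x ∂μ) * ∫ x, ψ j ω x * v l x ∂μ ∂P
      = p * (lam k * S.indicator (fun k => if k = l then (1 : ℝ) else 0) k) := by
  rcases Nat.eq_zero_or_pos p with rfl | hp
  · simp
  have h := integral_kernelOp_mul hm (fun j => (hψ j).memLp_prod (μ := μ) (hm j))
    (fun j => (hψ j).1) (hv l) (hv k)
  have h1 : ∫ x, kernelOp μ (implicitKernel P ψ) (v k) x * v l x ∂μ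
      = lam k * S.indicator (fun k => if k = l then (1 : ℝ) else 0) k := by
    rw [← hon, ← integral_const_mul]
    refine integral_congr_ae ?_
    filter_upwards [heigen k] with x hx
    rw [hx, mul_assoc]
  have hp0 : (p : ℝ) ≠ 0 := by positivity
  rw [← h1, h, mul_inv_cancel_left₀ hp0]

/-- The Karhunen–Loève series converges almost everywhere on the product space. -/
theorem ae_prod_seriesConvergesTo [BorelSpace Z] (hm : ∀ j, Measurable fun q : Ω × Z => ψ j q.1 q.2)
    (hψ : ∀ j, IsMeanSquareContinuous P (ψ j))
    (heig : IsEigensystem μ (implicitKernel P ψ) lam u)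
    (hlam : Summable fun k : ℕ => ((k : ℝ) + 1) * lam k) :
    ∀ᵐ q ∂P.prod μ, ∀ j, SeriesConvergesTo
      (fun k => feature lam u q.2 k * klMatrix μ ψ lam u q.1 j k)
      ((Real.sqrt p)⁻¹ * ψ j q.1 q.2) := by
  have : Fact ((2 : ENNReal) ≠ ⊤) := ⟨by simp⟩
  obtain ⟨v, hvm, hv, hon, heigen, hcomplete, hvu⟩ := heig.exists_measurable
  have hcoef : ∀ k, ∑ j, ∫ ω, (∫ x, ψ j ω x * v k x ∂μ) ^ 2 ∂P ≤ p * lam k := fun k => by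
    simp only [sq]
    rw [sum_integral_coefficient_mul hm hψ hv hon heigen k k]
    gcongr
    refine mul_le_of_le_one_right (heig.nonneg k) ?_
    simp only [Set.indicator]
    split_ifs <;> norm_num
  rw [ae_all_iff]
  intro j
  have hae := ae_ae_tendsto_sum hm (fun j => (hψ j).memLp_prod (μ := μ) (hm j))
    (fun j => (hψ j).1) hv hon hcomplete hcoef hlam j
  -- Passing from iterated to product null sets needs a measurable convergence set; hence the
  -- measurable versions `v k`.
  have hmeas : MeasurableSet {q : Ω × Z | Tendsto (fun r => ∑ k ∈ Finset.range r,
      (∫ y, ψ j q.1 y * v k y ∂μ) * v k q.2) atTop (𝓝 (ψ j q.1 q.2))} := by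
    refine measurableSet_tendsto_fun (fun r => Finset.measurable_sum _ fun k _ => ?_) (hm j)
    have h1 : Measurable fun ω => ∫ y, ψ j ω y * v k y ∂μ :=
      ((hm j).mul ((hvm k).comp measurable_snd)).stronglyMeasurable.integral_prod_right'.measurable
    exact (h1.comp measurable_fst).mul ((hvm k).comp measurable_snd)
  have hvu' : ∀ᵐ q ∂P.prod μ, ∀ k, lam k ≠ 0 → v k q.2 = u k q.2 :=
    Measure.quasiMeasurePreserving_snd.ae
      (ae_all_iff.2 fun k => eventually_imp_distrib_left.2 fun hk => hvu k hk)
  filter_upwards [(Measure.ae_prod_iff_ae_ae hmeas).2 hae, hvu'] with q hq hqu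
  have := hq.const_mul (Real.sqrt p)⁻¹
  refine this.congr fun r => ?_
  rw [Finset.mul_sum]
  refine Finset.sum_congr rfl fun k _ => ?_
  change _ = feature lam u q.2 k * klMatrix μ ψ lam u q.1 j k
  rw [klMatrix_apply_eq heig.nonneg heig.antitone hvu, feature]
  by_cases hk : lam k = 0
  · have h0 : v k =ᵐ[μ] 0 := by
      have h := hon k k
      rw [Set.indicator_of_notMem (by simpa using hk), integral_eq_zero_iff_of_nonneg
        (fun x => mul_self_nonneg _) (integrable_mul_of_memLp_two (hv k) (hv k))] at h
      filter_upwards [h] with x hx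
      exact mul_self_eq_zero.1 hx
    have h1 : ∫ y, ψ j q.1 y * v k y ∂μ = 0 := by
      rw [← integral_zero Z ℝ (μ := μ)]
      refine integral_congr_ae ?_
      filter_upwards [h0] with x hx
      rw [hx]
      simp
    simp [h1]
  · have hs : Real.sqrt (lam k) ≠ 0 :=
      (Real.sqrt_pos.2 (lt_of_le_of_ne (heig.nonneg k) (Ne.symm hk))).ne'
    rw [hqu k hk, Real.sqrt_mul (heig.nonneg k), mul_inv]
    field_simp

/-- The entries of `WᵀW` are integrable, and `WᵀW` has the identity matrix as its mean. -/
theorem integral_klMatrix_gram (hm : ∀ j, Measurable fun q : Ω × Z => ψ j q.1 q.2)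
    (hψ : ∀ j, IsMeanSquareContinuous P (ψ j))
    (heig : IsEigensystem μ (implicitKernel P ψ) lam u) (k l : ℕ) :
    Integrable (fun ω => ((klMatrix μ ψ lam u ω)ᵀ * klMatrix μ ψ lam u ω) k l) P ∧
      ∫ ω, ((klMatrix μ ψ lam u ω)ᵀ * klMatrix μ ψ lam u ω) k l ∂P = idMatrix (kmax lam) k l := by
  obtain ⟨v, -, hv, hon, heigen, -, hvu⟩ := heig.exists_measurable
  have hC : ∀ j k, MemLp (fun ω => ∫ x, ψ j ω x * v k x ∂μ) 2 P := fun j k =>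
    memLp_integral_mul ((hψ j).memLp_prod (hm j)) (hm j) (hv k)
  have hI : ∀ j, Integrable (fun ω => (Real.sqrt (lam k * p))⁻¹ * (Real.sqrt (lam l * p))⁻¹ *
      ((∫ x, ψ j ω x * v k x ∂μ) * ∫ x, ψ j ω x * v l x ∂μ)) P := fun j =>
    (integrable_mul_of_memLp_two (hC j k) (hC j l)).const_mul _
  have hgram : ∀ ω, ((klMatrix μ ψ lam u ω)ᵀ * klMatrix μ ψ lam u ω) k l
      = ∑ j, (Real.sqrt (lam k * p))⁻¹ * (Real.sqrt (lam l * p))⁻¹ *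
        ((∫ x, ψ j ω x * v k x ∂μ) * ∫ x, ψ j ω x * v l x ∂μ) := fun ω => by
    rw [Matrix.mul_apply]
    refine Finset.sum_congr rfl fun j _ => ?_
    rw [Matrix.transpose_apply, klMatrix_apply_eq heig.nonneg heig.antitone hvu,
      klMatrix_apply_eq heig.nonneg heig.antitone hvu]
    ring
  simp only [hgram]
  refine ⟨integrable_finsetSum _ fun j _ => hI j, ?_⟩
  rw [integral_finsetSum _ fun j _ => hI j]
  simp only [integral_const_mul]
  rw [← Finset.mul_sum, sum_integral_coefficient_mul hm hψ hv hon heigen]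
  simp only [idMatrix, Matrix.of_apply, lt_kmax_iff heig.nonneg heig.antitone, Set.indicator]
  by_cases hk : lam k = 0
  · simp [hk]
  by_cases hkl : k = l
  · subst hkl
    have hpos : 0 < lam k := lt_of_le_of_ne (heig.nonneg k) (Ne.symm hk)
    -- For `p = 0` the kernel vanishes, which is incompatible with a non-zero eigenvalue.
    have hp : 0 < (p : ℝ) := by
      rw [Nat.cast_pos]
      by_contra! h0
      obtain rfl : p = 0 := by omega
      have h1 := hon k k
      rw [Set.indicator_of_mem (by simpa using hk), if_pos rfl] at h1
      have h2 : v k =ᵐ[μ] 0 := by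
        filter_upwards [heigen k] with x hx
        simpa [kernelOp, implicitKernel, hk] using hx.symm
      have h3 : ∫ x, v k x * v k x ∂μ = 0 := by
        rw [← integral_zero Z ℝ (μ := μ)]
        refine integral_congr_ae ?_
        filter_upwards [h2] with x hx
        rw [hx]
        simp
      exact one_ne_zero (h1.symm.trans h3)
    have hsq := Real.mul_self_sqrt (mul_pos hpos hp).le
    simp only [Set.mem_ofPred_eq, ne_eq, hk, not_false_eq_true, if_true, and_self, mul_one]
    rw [← mul_inv, hsq, mul_comm (p : ℝ), inv_mul_cancel₀ (mul_pos hpos hp).ne']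
  · simp [hkl]

end KarhunenLoeve

/-! ### Evaluation at an independent random point -/

section Pullback

variable {Ω Ω' Z : Type*} [MeasurableSpace Ω] [MeasurableSpace Ω'] {P : Measure Ω}
  {π : Ω → Ω'}

theorem IsMeanSquareContinuous.map [TopologicalSpace Z] (hπ : Measurable π) {f : Ω' → Z → ℝ}
    (hm : ∀ x, Measurable fun ω => f ω x)
    (hf : IsMeanSquareContinuous P fun ω => f (π ω)) : IsMeanSquareContinuous (P.map π) f := by
  refine ⟨fun x => (memLp_map_measure_iff (hm x).aestronglyMeasurable hπ.aemeasurable).2 (hf.1 x),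
    fun x => (hf.2 x).congr fun y => ?_⟩
  exact (integral_map hπ.aemeasurable
    (((hm x).sub (hm y)).abs.pow_const 2).aestronglyMeasurable).symm

theorem implicitKernel_map (hπ : Measurable π) {p : ℕ} {ψ : Fin p → Ω' → Z → ℝ}
    (hm : ∀ j x, Measurable fun ω => ψ j ω x) :
    implicitKernel (P.map π) ψ = implicitKernel P fun j ω => ψ j (π ω) := by
  funext x y
  rw [implicitKernel, implicitKernel, integral_map hπ.aemeasurable]
  exact (Finset.measurable_sum _ fun j _ => (hm j x).mul (hm j y)).aestronglyMeasurable

/-- The Karhunen–Loève series converges almost surely at an independent random point. -/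
theorem ae_seriesConvergesTo_of_indepFun [IsProbabilityMeasure P] [MetricSpace Z] [CompactSpace Z] [MeasurableSpace Z]
    [BorelSpace Z] {μ : Measure Z} {p : ℕ} {ψ : Fin p → Ω' → Z → ℝ} {lam : ℕ → ℝ}
    {u : ℕ → Z → ℝ} (hπ : Measurable π) {ζ : Ω → Z} (hζ : Measurable ζ) (hmap : P.map ζ = μ)
    (hind : IndepFun π ζ P) (hm : ∀ j, Measurable fun q : Ω' × Z => ψ j q.1 q.2)
    (hψ : ∀ j, IsMeanSquareContinuous P fun ω => ψ j (π ω))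
    (heig : IsEigensystem μ (implicitKernel P fun j ω => ψ j (π ω)) lam u)
    (hlam : Summable fun k : ℕ => ((k : ℝ) + 1) * lam k) :
    ∀ᵐ ω ∂P, ∀ j, SeriesConvergesTo
      (fun k => feature lam u (ζ ω) k * klMatrix μ ψ lam u (π ω) j k)
      ((Real.sqrt p)⁻¹ * ψ j (π ω) (ζ ω)) := by
  have hsec : ∀ j x, Measurable fun ω => ψ j ω x := fun j x =>
    (hm j).comp measurable_prodMk_right
  have : IsProbabilityMeasure (P.map π) := Measure.isProbabilityMeasure_map hπ.aemeasurable
  have : IsProbabilityMeasure μ := hmap ▸ Measure.isProbabilityMeasure_map hζ.aemeasurable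
  rw [← implicitKernel_map hπ hsec] at heig
  have h := ae_prod_seriesConvergesTo hm (fun j => (hψ j).map hπ (hsec j)) heig hlam
  have hlaw := (indepFun_iff_map_prod_eq_prod_map_map hπ.aemeasurable hζ.aemeasurable).1 hind
  rw [hmap] at hlaw
  rw [← hlaw] at h
  exact ae_of_ae_map (hπ.prodMk hζ).aemeasurable h

end Pullback

/-- In the latent metric model, the Karhunen–Loève series converges almost surely at each latent
variable. -/
theorem IsLMM.ae_seriesConvergesTo {Ω Z : Type*} [mΩ : MeasurableSpace Ω]
    [MetricSpace Z] [CompactSpace Z] [mZ : MeasurableSpace Z] [BorelSpace Z]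
    {P : Measure Ω} [IsProbabilityMeasure P] {μ : Measure Z} {n p : ℕ} {σ : ℝ}
    {ψ : Fin p → Ω → Z → ℝ} {z : Fin n → Ω → Z} {ztest : Ω → Z}
    {e : Fin n → Ω → Fin p → ℝ} {etest : Ω → Fin p → ℝ}
    (hmodel : IsLMM P μ σ ψ z ztest e etest)
    (hψ : ∀ j, IsMeanSquareContinuous P (ψ j)) {lam : ℕ → ℝ} {u : ℕ → Z → ℝ}
    (heig : IsEigensystem μ (implicitKernel P ψ) lam u)
    (hlam : Summable fun k : ℕ => ((k : ℝ) + 1) * lam k) (i : Option (Fin n)) :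
    ∀ᵐ ω ∂P, ∀ j, SeriesConvergesTo
      (fun k => feature lam u (withTest z ztest i ω) k * klMatrix μ ψ lam u ω j k)
      ((Real.sqrt p)⁻¹ * ψ j ω (withTest z ztest i ω)) := by
  have hz := hmodel.measurable_z i
  have hmap := hmodel.map_z i
  obtain ⟨𝓖, h𝓖, hm, hind⟩ := hmodel.independent_sources
  have h01 := hind.indep (i := 0) (j := 1) (by decide)
  have hle : MeasurableSpace.comap (withTest z ztest i) mZ ≤
      MeasurableSpace.comap (fun ω i => withTest z ztest i ω) MeasurableSpace.pi := by
    have : withTest z ztest i = (fun y : Option (Fin n) → Z => y i) ∘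
      fun ω i => withTest z ztest i ω := rfl
    rw [this, ← MeasurableSpace.comap_comp]
    exact MeasurableSpace.comap_mono (measurable_pi_apply i).comap_le
  -- The randomness of `ψ` is carried by the identity map into `Ω` with the smaller σ-algebra `𝓖`:
  -- this map is independent of the latent variable, and `ψ` is jointly measurable over `𝓖`.
  have hid : @Measurable Ω Ω mΩ 𝓖 id := measurable_id'' h𝓖
  have hif : @IndepFun Ω Ω Z mΩ 𝓖 mZ id (withTest z ztest i) P := by
    rw [IndepFun_iff_Indep, MeasurableSpace.comap_id]
    exact indep_of_indep_of_le_right h01 hle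
  exact @ae_seriesConvergesTo_of_indepFun Ω Ω Z mΩ 𝓖 P id _ _ _ mZ _ μ p ψ lam u
    hid _ hz hmap hif hm hψ heig hlam

end LatentMetricModel

open LatentMetricModel in
theorem proposition1 {Ω Z : Type*} [MeasurableSpace Ω]
    [MetricSpace Z] [CompactSpace Z] [MeasurableSpace Z] [BorelSpace Z]
    (P : Measure Ω) [IsProbabilityMeasure P] (μ : Measure Z) {n p : ℕ} (σ : ℝ)
    (ψ : Fin p → Ω → Z → ℝ) (z : Fin n → Ω → Z) (ztest : Ω → Z)
    (e : Fin n → Ω → Fin p → ℝ) (etest : Ω → Fin p → ℝ)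
    (hmodel : IsLMM P μ σ ψ z ztest e etest)
    (hψ : ∀ j, IsMeanSquareContinuous P (ψ j))
    (lam : ℕ → ℝ) (u : ℕ → Z → ℝ)
    (heig : IsEigensystem μ (implicitKernel P ψ) lam u)
    (hlam : Summable fun k : ℕ => ((k : ℝ) + 1) * lam k) :
    (∀ᵐ ω ∂P, ∀ (j : Fin p) (k : ℕ), (k : ℕ∞) < kmax lam →
      Integrable (fun x => ψ j ω x * u k x) μ) ∧
    (∀ᵐ ω ∂P, ∃ M : Matrix (Fin n) (Fin p) ℝ,
      IsProduct (featureMatrix lam u z ω) (klMatrix μ ψ lam u ω)ᵀ M ∧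
      covariateMatrix ψ σ z e ω = Real.sqrt p • M + σ • noiseMatrix e ω) ∧
    (∀ᵐ ω ∂P, ∃ v : Fin p → ℝ,
      IsProductVec (klMatrix μ ψ lam u ω) (feature lam u (ztest ω)) v ∧
      covariate ψ σ ztest etest ω = Real.sqrt p • v + σ • etest ω) ∧
    (∀ k l : ℕ, Integrable (fun ω => ((klMatrix μ ψ lam u ω)ᵀ * klMatrix μ ψ lam u ω) k l) P ∧
      ∫ ω, ((klMatrix μ ψ lam u ω)ᵀ * klMatrix μ ψ lam u ω) k l ∂P = idMatrix (kmax lam) k l) := by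
  have := hmodel.isProbabilityMeasure_latent
  have hm : ∀ j, Measurable fun q : Ω × Z => ψ j q.1 q.2 := by
    obtain ⟨𝓖, h𝓖, hm, -⟩ := hmodel.independent_sources
    exact fun j => (hm j).mono (sup_le_sup (MeasurableSpace.comap_mono h𝓖) le_rfl) le_rfl
  have hconv := fun i => hmodel.ae_seriesConvergesTo hψ heig hlam i
  -- The index in `Fin p` serves only to guarantee `p > 0`.
  have hsqrt : ∀ (_ : Fin p) (a : ℝ), Real.sqrt p * ((Real.sqrt p)⁻¹ * a) = a := fun j a =>
    mul_inv_cancel_left₀ (Real.sqrt_pos.2 (Nat.cast_pos.2 j.pos)).ne' a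
  refine ⟨?_, ?_, ?_, fun k l => integral_klMatrix_gram hm hψ heig k l⟩
  · have hL := ae_all_iff.2 fun j => ae_memLp_section ((hψ j).memLp_prod (μ := μ) (hm j)) (hm j)
    filter_upwards [hL] with ω hω j k hk
    exact integrable_mul_of_memLp_two (hω j)
      (heig.memLp k ((lt_kmax_iff heig.nonneg heig.antitone k).1 hk))
  · filter_upwards [ae_all_iff.2 fun i : Fin n => hconv (some i)] with ω hω
    refine ⟨Matrix.of fun i j => (Real.sqrt p)⁻¹ * ψ j ω (z i ω), fun i j => hω i j, ?_⟩
    ext i j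
    simp [covariateMatrix, covariate, noiseMatrix, hsqrt j]
  · filter_upwards [hconv none] with ω hω
    refine ⟨fun j => (Real.sqrt p)⁻¹ * ψ j ω (ztest ω), fun j => ?_, ?_⟩
    · exact (hω j).congr fun r => Finset.sum_congr rfl fun k _ => mul_comm _ _
    · ext j
      simp [covariate, hsqrt j]
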